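/- Let $\kappa$ be an infinite cardinal, and let $\mathfrak{d}$ be the dominating number, i.e. the least cardinality of a family $D\subseteq\omega^{\omega}$ such that for each $f\in\omega^\omega$ there is $g\in D$ with $f(n)\le g(n)$ for all but finitely many $n$. For a topological space $X$, $A\subseteq X$ and $x\in X$ let $$\mathrm{cl}_\theta(A)=\{y\in X:\ \overline{U}\cap A\ne\emptyset\text{ for every neighborhood }U\text{ of }y\},\qquad \Omega^\theta_x=\{A\subseteq X\setminus\{x\}:\ x\in\mathrm{cl}_\theta(A)\}.$$ Let $t_\theta(X,x)$ be the least infinite cardinal $\mu$ such that each $A\in\Omega^\theta_x$ has a subset $C$ with $|C|\le\mu$ and $x\in\mathrm{cl}_\theta(C)$. Let $\chi_\theta(X,x)$ be the least cardinality of a family $\mathcal N$ of nonempty open subsets of $X$ such that for every open $U$ with $x\in U$ there is $N\in\mathcal N$ with $x\in N\subseteq\overline{U}$. For families $\mathcal A,\mathcal B$ of subsets of $X$, $\mathsf{S}_{fin}(\mathcal A,\mathcal B)$ states: for each sequence $(A_n)_{n<\omega}$ of elements of $\mathcal A$ there are finite sets $B_n\subseteq A_n$ with $\bigcup_{n<\omega}B_n\in\mathcal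 B$. In the game $\mathsf{G}_{fin}(\mathcal A,\mathcal B)$ of length $\omega$, in inning $n$ player ONE chooses $O_n\in\mathcal A$ and player TWO responds with a finite $T_n\subseteq O_n$; TWO wins the play if $\bigcup_{n<\omega}T_n\in\mathcal B$, and otherwise ONE wins. Then the following are equivalent: 1. $\kappa<\mathfrak{d}$. 2. For each $\mathsf{T}_1$-space $X$ without isolated points and each point $x\in X$ with $t_\theta(X,x)=\aleph_0$ and $\chi_\theta(X,x)\le\kappa$, ONE has no winning strategy in the game $\mathsf{G}_{fin}(\Omega^\theta_x,\Omega^\theta_x)$. 3. For each $\mathsf{T}_1$-space $X$ without isolated points and each point $x\in X$ with $t_\theta(X,x)=\aleph_0$ and $\chi_\theta(X,x)\le\kappa$, the selection principle $\mathsf{S}_{fin}(\Omega^\theta_x,\Omega^\theta_x)$ holds. -/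

import Mathlib

open Set Filter Topology

universe u

/-- The dominating number `𝔡`: the least cardinality of a family `D` of functions `ℕ → ℕ` such that
every function `ℕ → ℕ` is eventually bounded by some member of `D`. -/
noncomputable def dominatingNumber : Cardinal.{0} :=
  sInf {c | ∃ D : Set (ℕ → ℕ), (∀ f : ℕ → ℕ, ∃ g ∈ D, ∀ᶠ n in atTop, f n ≤ g n) ∧
    Cardinal.mk D = c}

/-- The `θ`-closure of `A`: the points all of whose neighbourhoods have a closure meeting `A`. -/
def thetaClosure {X : Type u} [TopologicalSpace X] (A : Set X) : Set X :=
  {x | ∀ U ∈ 𝓝 x, (closure U ∩ A).Nonempty}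

/-- The family `Ω^θ_x` of all `A ⊆ X \ {x}` with `x` in the `θ`-closure of `A`. -/
def thetaOmega {X : Type u} [TopologicalSpace X] (x : X) : Set (Set X) :=
  {A | A ⊆ {x}ᶜ ∧ x ∈ thetaClosure A}

/-- The `θ`-tightness `t_θ(X, x)`: the least infinite cardinal `μ` such that each `A ⊆ X \ {x}` with
`x` in the `θ`-closure of `A` has a subset `C` of cardinality at most `μ` with `x` in the
`θ`-closure of `C`. -/
noncomputable def thetaTightness (X : Type u) [TopologicalSpace X] (x : X) : Cardinal.{u} :=
  sInf {μ | Cardinal.aleph0 ≤ μ ∧ ∀ A : Set X, A ⊆ {x}ᶜ → x ∈ thetaClosure A →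
    ∃ C ⊆ A, x ∈ thetaClosure C ∧ Cardinal.mk C ≤ μ}

/-- `N` is a `θ`-neighbourhood base at `x`: a family of nonempty open sets such that each open `U`
containing `x` admits some `V ∈ N` with `x ∈ V ⊆ closure U`. -/
def IsThetaNhdsBase {X : Type u} [TopologicalSpace X] (x : X) (N : Set (Set X)) : Prop :=
  (∀ V ∈ N, IsOpen V ∧ V.Nonempty) ∧
    ∀ U : Set X, IsOpen U → x ∈ U → ∃ V ∈ N, x ∈ V ∧ V ⊆ closure U

/-- The `θ`-character `χ_θ(X, x)`: the least cardinality of a `θ`-neighbourhood base at `x`. -/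
noncomputable def thetaCharacter (X : Type u) [TopologicalSpace X] (x : X) : Cardinal.{u} :=
  sInf {c | ∃ N : Set (Set X), IsThetaNhdsBase x N ∧ Cardinal.mk N = c}

/-- The selection principle `S_fin(𝒜, ℬ)`. -/
def SFin {X : Type u} (𝒜 ℬ : Set (Set X)) : Prop :=
  ∀ A : ℕ → Set X, (∀ n, A n ∈ 𝒜) →
    ∃ B : ℕ → Finset X, (∀ n, (B n : Set X) ⊆ A n) ∧ (⋃ n, (B n : Set X)) ∈ ℬ

/-- A strategy for ONE in the game `G_fin(𝒜, ℬ)`: a rule giving a legal move (an element of `𝒜`)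
for each finite list of moves made so far by TWO (in order; the empty list gives the first move).
ONE's own earlier moves are determined by the strategy. -/
abbrev OneStrategy {X : Type u} (𝒜 : Set (Set X)) : Type u :=
  List (Finset X) → {O : Set X // O ∈ 𝒜}

/-- ONE's move in inning `n` when ONE follows `σ` and TWO's move in inning `i` is `T i`. -/
def OneStrategy.move {X : Type u} {𝒜 : Set (Set X)} (σ : OneStrategy 𝒜) (T : ℕ → Finset X)
    (n : ℕ) : Set X :=
  (σ ((List.range n).map T)).1

/-- `σ` is winning for ONE in `G_fin(𝒜, ℬ)`: in every play in which ONE follows `σ` and TWO always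
answers by a finite subset of ONE's current move, the union of TWO's answers is not in `ℬ`. -/
def OneStrategy.IsWinningFin {X : Type u} {𝒜 : Set (Set X)} (σ : OneStrategy 𝒜)
    (ℬ : Set (Set X)) : Prop :=
  ∀ T : ℕ → Finset X, (∀ n, (T n : Set X) ⊆ σ.move T n) → (⋃ n, (T n : Set X)) ∉ ℬ

/-- ONE has a winning strategy in the game `G_fin(𝒜, ℬ)`. -/
def OneWinsGFin {X : Type u} (𝒜 ℬ : Set (Set X)) : Prop :=
  ∃ σ : OneStrategy 𝒜, σ.IsWinningFin ℬ

section ThetaBase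

variable {X : Type u} [TopologicalSpace X] {x : X}

/-- Membership in the `θ`-closure can be tested on a `θ`-neighbourhood base. -/
theorem IsThetaNhdsBase.mem_thetaClosure {N : Set (Set X)} (hN : IsThetaNhdsBase x N)
    {A : Set X} (h : ∀ V ∈ N, x ∈ V → (closure V ∩ A).Nonempty) : x ∈ thetaClosure A := by
  intro U hU
  obtain ⟨W, hWU, hW, hxW⟩ := mem_nhds_iff.1 hU
  obtain ⟨V, hV, hxV, hVW⟩ := hN.2 W hW hxW
  obtain ⟨a, haV, haA⟩ := h V hV hxV
  exact ⟨a, closure_mono hWU (closure_minimal hVW isClosed_closure haV), haA⟩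

variable (x) in
theorem exists_isThetaNhdsBase_mk_eq :
    ∃ N : Set (Set X), IsThetaNhdsBase x N ∧ Cardinal.mk N = thetaCharacter X x :=
  csInf_mem (s := {c | ∃ N : Set (Set X), IsThetaNhdsBase x N ∧ Cardinal.mk N = c})
    ⟨_, {V | IsOpen V ∧ V.Nonempty}, ⟨fun _ h => h, fun U hU hx =>
      ⟨U, ⟨hU, x, hx⟩, hx, subset_closure⟩⟩, rfl⟩

theorem exists_countable_subset_of_thetaTightness (h : thetaTightness X x = Cardinal.aleph0)
    {A : Set X} (hA : A ∈ thetaOmega x) : ∃ C ⊆ A, x ∈ thetaClosure C ∧ C.Countable := by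
  have hne : {μ | Cardinal.aleph0 ≤ μ ∧ ∀ A : Set X, A ⊆ {x}ᶜ → x ∈ thetaClosure A →
      ∃ C ⊆ A, x ∈ thetaClosure C ∧ Cardinal.mk C ≤ μ}.Nonempty := by
    -- An infimum over the empty set would be `0`, not `ℵ₀`.
    by_contra hne
    rw [Set.not_nonempty_iff_eq_empty] at hne
    rw [thetaTightness, hne, Cardinal.sInf_empty] at h
    exact Cardinal.aleph0_ne_zero h.symm
  have hmem := csInf_mem hne
  obtain ⟨C, hCA, hxC, hC⟩ := hmem.2 A hA.1 hA.2
  exact ⟨C, hCA, hxC, Cardinal.le_aleph0_iff_set_countable.1 (hC.trans h.le)⟩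

theorem exists_seq_of_thetaTightness (h : thetaTightness X x = Cardinal.aleph0)
    {A : Set X} (hA : A ∈ thetaOmega x) :
    ∃ e : ℕ → X, range e ⊆ A ∧ x ∈ thetaClosure (range e) := by
  obtain ⟨C, hCA, hxC, hC⟩ := exists_countable_subset_of_thetaTightness h hA
  have hne : C.Nonempty := (hxC univ univ_mem).mono inter_subset_right
  obtain ⟨e, rfl⟩ := hC.exists_eq_range hne
  exact ⟨e, hCA, hxC⟩

theorem thetaTightness_eq_aleph0 [Countable X] (x : X) :
    thetaTightness X x = Cardinal.aleph0 := by
  have hmem : Cardinal.aleph0 ∈ {μ | Cardinal.aleph0 ≤ μ ∧ ∀ A : Set X, A ⊆ {x}ᶜ →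
      x ∈ thetaClosure A → ∃ C ⊆ A, x ∈ thetaClosure C ∧ Cardinal.mk C ≤ μ} :=
    ⟨le_rfl, fun A _ hx => ⟨A, Subset.rfl, hx,
      Cardinal.le_aleph0_iff_set_countable.2 A.to_countable⟩⟩
  exact le_antisymm (csInf_le' hmem) (le_csInf ⟨_, hmem⟩ fun _ h => h.1)

end ThetaBase

theorem dominatingNumber_le_mk {D : Set (ℕ → ℕ)}
    (hD : ∀ f : ℕ → ℕ, ∃ g ∈ D, ∀ᶠ n in atTop, f n ≤ g n) :
    dominatingNumber ≤ Cardinal.mk D :=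
  csInf_le' ⟨D, hD, rfl⟩

theorem exists_dominating_mk_eq :
    ∃ D : Set (ℕ → ℕ), (∀ f : ℕ → ℕ, ∃ g ∈ D, ∀ᶠ n in atTop, f n ≤ g n) ∧
      Cardinal.mk D = dominatingNumber :=
  csInf_mem (s := {c | ∃ D : Set (ℕ → ℕ), (∀ f : ℕ → ℕ, ∃ g ∈ D, ∀ᶠ n in atTop, f n ≤ g n) ∧
    Cardinal.mk D = c}) ⟨_, univ, fun f => ⟨f, mem_univ _, by simp⟩, rfl⟩

/-- A family indexed by `ι` and dominating everywhere has at least `𝔡` many indices. -/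
theorem lift_dominatingNumber_le {ι : Type u} (F : ι → ℕ → ℕ)
    (hF : ∀ f : ℕ → ℕ, ∃ i, ∀ n, f n ≤ F i n) :
    Cardinal.lift.{u} dominatingNumber ≤ Cardinal.mk ι := by
  have h := dominatingNumber_le_mk (D := range F) fun f => by
    obtain ⟨i, hi⟩ := hF f
    exact ⟨F i, mem_range_self i, Eventually.of_forall hi⟩
  have h' := Cardinal.mk_range_le_lift (f := F)
  rw [Cardinal.lift_id'] at h'
  exact (Cardinal.lift_le.2 h).trans (by simpa using h')

/-! ### The game below `𝔡` -/

section Game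

open Classical in
/-- TWO's answer at history `L`: the first `k + 1` terms of the sequence `e L`. -/
noncomputable def initialAnswer {X : Type u} (e : List (Finset X) → ℕ → X)
    (L : List (Finset X)) (k : ℕ) : Finset X :=
  (Finset.range (k + 1)).image (e L)

/-- The history after `n` innings in which TWO picks lengths according to `f`. -/
noncomputable def playHistory {X : Type u} (e : List (Finset X) → ℕ → X) (f : ℕ → ℕ) :
    ℕ → List (Finset X)
  | 0 => []
  | n + 1 => playHistory e f n ++ [initialAnswer e (playHistory e f n) (f n)]

theorem playHistory_eq_map {X : Type u} (e : List (Finset X) → ℕ → X) (f : ℕ → ℕ) (n : ℕ) :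
    playHistory e f n =
      (List.range n).map fun i => initialAnswer e (playHistory e f i) (f i) := by
  induction n with
  | zero => rfl
  | succ n ih =>
    rw [List.range_succ, List.map_append, ← ih]
    rfl

open Classical in
/-- The histories of length `n` in which TWO's lengths are bounded by the values of `μ`
encountered at the same inning. -/
noncomputable def boundedHistories {X : Type u} (e : List (Finset X) → ℕ → X)
    (μ : List (Finset X) → ℕ) : ℕ → Finset (List (Finset X))
  | 0 => {[]}
  | n + 1 => (boundedHistories e μ n).biUnion fun L =>
      (Finset.range ((boundedHistories e μ n).sup μ + 1)).image fun k => L ++ [initialAnswer e L k]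

theorem playHistory_mem_boundedHistories {X : Type u} {e : List (Finset X) → ℕ → X}
    {μ : List (Finset X) → ℕ} {f : ℕ → ℕ} (h : ∀ n, f n ≤ μ (playHistory e f n)) (n : ℕ) :
    playHistory e f n ∈ boundedHistories e μ n := by
  classical
  induction n with
  | zero => simp [playHistory, boundedHistories]
  | succ n ih =>
    simp only [boundedHistories, playHistory, Finset.mem_biUnion, Finset.mem_image,
      Finset.mem_range]
    exact ⟨_, ih, f n, Nat.lt_succ_of_le ((h n).trans (Finset.le_sup (f := μ) ih)), rfl⟩

theorem not_oneWinsGFin_of_lt {X : Type u} [TopologicalSpace X] {x : X}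
    (ht : thetaTightness X x = Cardinal.aleph0)
    (hχ : thetaCharacter X x < Cardinal.lift.{u} dominatingNumber) :
    ¬ OneWinsGFin (thetaOmega x) (thetaOmega x) := by
  rintro ⟨σ, hσ⟩
  obtain ⟨N, hN, hcard⟩ := exists_isThetaNhdsBase_mk_eq x
  choose e heσ hex using fun L => exists_seq_of_thetaTightness ht (σ L).2
  -- The first index at which `e L` enters `closure V`. The default `0` for an empty set is
  -- harmless: only `V` containing `x` are used, and their closures meet every `e L`.
  let μ : Set X → List (Finset X) → ℕ := fun V L => sInf {m | e L m ∈ closure V}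
  refine (hcard ▸ hχ).not_ge (lift_dominatingNumber_le
    (fun V : N => fun n => (boundedHistories e (μ V) n).sup (μ V)) fun f => ?_)
  let T : ℕ → Finset X := fun n => initialAnswer e (playHistory e f n) (f n)
  have hT : ∀ n, (T n : Set X) ⊆ σ.move T n := by
    intro n
    rw [OneStrategy.move, ← playHistory_eq_map e f n]
    refine Subset.trans ?_ (heσ (playHistory e f n))
    simp only [T, initialAnswer, Finset.coe_image]
    exact image_subset_range _ _
  have hx : x ∉ thetaClosure (⋃ n, (T n : Set X)) := fun hx =>
    hσ T hT ⟨iUnion_subset fun n => (hT n).trans (σ _).2.1, hx⟩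
  obtain ⟨V, hV, hxV, hdisj⟩ : ∃ V ∈ N, x ∈ V ∧ ¬ (closure V ∩ ⋃ n, (T n : Set X)).Nonempty := by
    by_contra! h
    exact hx (hN.mem_thetaClosure h)
  have hf : ∀ n, f n ≤ μ V (playHistory e f n) := by
    intro n
    obtain ⟨_, ha, m, rfl⟩ := hex (playHistory e f n) V ((hN.1 V hV).1.mem_nhds hxV)
    have hmem : e (playHistory e f n) (μ V (playHistory e f n)) ∈ closure V :=
      Nat.sInf_mem (s := {m | e (playHistory e f n) m ∈ closure V}) ⟨m, ha⟩
    -- Otherwise TWO's answer already contains a point of `closure V`.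
    by_contra! hlt
    refine hdisj ⟨_, hmem, mem_iUnion.2 ⟨n, ?_⟩⟩
    simp only [T, initialAnswer, Finset.coe_image]
    exact mem_image_of_mem _ (by simpa using hlt.le.trans_lt (Nat.lt_succ_self _))
  exact ⟨⟨V, hV⟩, fun n =>
    (hf n).trans (Finset.le_sup (f := μ V) (playHistory_mem_boundedHistories hf n))⟩

theorem sFin_of_not_oneWinsGFin {X : Type u} {𝒜 ℬ : Set (Set X)} (h : ¬ OneWinsGFin 𝒜 ℬ) :
    SFin 𝒜 ℬ := by
  intro A hA
  by_contra! hB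
  -- ONE plays the given sequence, reading off only the inning number.
  refine h ⟨fun L => ⟨A L.length, hA _⟩, fun T hT => hB T fun n => ?_⟩
  simpa [OneStrategy.move] using hT n

end Game

/-! ### The fan as counterexample when `𝔡 ≤ κ` -/

/-- A countable fan without isolated points: countably many spines, each consisting of countably
many copies of `ℚ`, together with a vertex `none`. -/
def RatFan : Type u := Option (ℕ × ℕ × ULift.{u} ℚ)

namespace RatFan

instance : Countable RatFan.{u} :=
  inferInstanceAs (Countable (Option (ℕ × ℕ × ULift.{u} ℚ)))

/-- The vertex of the fan. -/
def vertex : RatFan.{u} := none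

/-- The point `q` of the `m`-th copy of `ℚ` in the `n`-th spine. -/
def point (n m : ℕ) (q : ℚ) : RatFan.{u} := some (n, m, ⟨q⟩)

theorem point_ne_vertex (n m : ℕ) (q : ℚ) : point.{u} n m q ≠ vertex :=
  Option.some_ne_none _

theorem point_inj {n m n' m' : ℕ} {q q' : ℚ} :
    point.{u} n m q = point n' m' q' ↔ n = n' ∧ m = m' ∧ q = q' := by
  refine Option.some_inj.trans ?_
  simp only [Prod.mk.injEq, ULift.up.injEq]

theorem eq_vertex_or_point (y : RatFan.{u}) : y = vertex ∨ ∃ n m q, y = point n m q := by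
  rcases y with _ | ⟨n, m, ⟨q⟩⟩
  · exact Or.inl rfl
  · exact Or.inr ⟨n, m, q, rfl⟩

/-- Each copy of `ℚ` is open with its usual topology; a neighbourhood of the vertex contains all
but finitely many copies in every spine. -/
instance : TopologicalSpace RatFan.{u} where
  IsOpen U := (∀ n m, IsOpen {q | point n m q ∈ U}) ∧
    (vertex ∈ U → ∃ g : ℕ → ℕ, ∀ n m q, g n < m → point n m q ∈ U)
  isOpen_univ := ⟨fun _ _ => by simp, fun _ => ⟨0, fun _ _ _ _ => mem_univ _⟩⟩
  isOpen_inter U V hU hV := by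
    refine ⟨fun n m => (hU.1 n m).inter (hV.1 n m), fun h => ?_⟩
    obtain ⟨g, hg⟩ := hU.2 h.1
    obtain ⟨g', hg'⟩ := hV.2 h.2
    exact ⟨g ⊔ g', fun n m q hm => ⟨hg n m q ((le_max_left _ _).trans_lt hm),
      hg' n m q ((le_max_right _ _).trans_lt hm)⟩⟩
  isOpen_sUnion S hS := by
    refine ⟨fun n m => ?_, fun ⟨U, hU, h⟩ => ?_⟩
    · have : {q | point n m q ∈ ⋃₀ S} = ⋃ U ∈ S, {q | point n m q ∈ U} := by
        ext q; simp
      rw [this]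
      exact isOpen_biUnion fun U hU => (hS U hU).1 n m
    · obtain ⟨g, hg⟩ := (hS U hU).2 h
      exact ⟨g, fun n m q hm => ⟨U, hU, hg n m q hm⟩⟩

theorem isOpen_iff {U : Set RatFan.{u}} : IsOpen U ↔ (∀ n m, IsOpen {q | point n m q ∈ U}) ∧
    (vertex ∈ U → ∃ g : ℕ → ℕ, ∀ n m q, g n < m → point n m q ∈ U) :=
  Iff.rfl

instance : T1Space RatFan.{u} where
  t1 y := by
    rw [← isOpen_compl_iff, isOpen_iff]
    rcases eq_vertex_or_point y with rfl | ⟨n₀, m₀, q₀, rfl⟩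
    · simp [point_ne_vertex]
    · refine ⟨fun n m => ?_, fun _ => ⟨fun _ => m₀, fun n m q hm h => ?_⟩⟩
      · by_cases h : n = n₀ ∧ m = m₀
        · obtain ⟨rfl, rfl⟩ := h
          simpa [point_inj, compl_def] using isOpen_compl_singleton (x := q₀)
        · have : {q | point.{u} n m q ∈ ({point n₀ m₀ q₀}ᶜ : Set RatFan.{u})} = univ := by
            ext q
            simp only [mem_ofPred_eq, mem_compl_iff, mem_singleton_iff, point_inj, mem_univ,
              iff_true]
            tauto
          rw [this]
          exact isOpen_univ
      · exact hm.ne' (point_inj.1 h).2.1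

theorem not_isOpen_singleton_ratFan (y : RatFan.{u}) : ¬ IsOpen ({y} : Set RatFan.{u}) := by
  rw [isOpen_iff]
  rintro ⟨h₁, h₂⟩
  rcases eq_vertex_or_point y with rfl | ⟨n, m, q, rfl⟩
  · obtain ⟨g, hg⟩ := h₂ rfl
    exact point_ne_vertex _ _ _ (hg 0 (g 0 + 1) 0 (Nat.lt_succ_self _))
  · have h := h₁ n m
    simp only [mem_singleton_iff, point_inj, true_and] at h
    exact not_isOpen_singleton q h

/-- The basic neighbourhood of the vertex given by `g`. -/
def vertexNhd (g : ℕ → ℕ) : Set RatFan.{u} :=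
  {y | ∀ n m q, y = point n m q → g n < m}

theorem point_mem_vertexNhd {g : ℕ → ℕ} {n m : ℕ} {q : ℚ} :
    point.{u} n m q ∈ vertexNhd g ↔ g n < m := by
  constructor
  · exact fun h => h n m q rfl
  · rintro h n' m' q' h'
    obtain ⟨rfl, rfl, rfl⟩ := point_inj.1 h'
    exact h

theorem vertex_mem_vertexNhd (g : ℕ → ℕ) : vertex.{u} ∈ vertexNhd g :=
  fun n m q h => (point_ne_vertex n m q h.symm).elim

/-- Each copy of `ℚ` lies wholly inside or wholly outside the set. Being clopen, these sets make the
closures in the `θ`-notions harmless at the vertex. -/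
theorem isClopen_vertexNhd (g : ℕ → ℕ) : IsClopen (vertexNhd.{u} g) := by
  refine ⟨isOpen_compl_iff.1 (isOpen_iff.2 ⟨fun n m => ?_, fun h =>
    (h (vertex_mem_vertexNhd g)).elim⟩), isOpen_iff.2 ⟨fun n m => ?_, fun _ =>
    ⟨g, fun n m q hm => point_mem_vertexNhd.2 hm⟩⟩⟩
  · simp only [mem_compl_iff, point_mem_vertexNhd, isOpen_const]
  · simp only [point_mem_vertexNhd, isOpen_const]

theorem exists_vertexNhd_subset {U : Set RatFan.{u}} (hU : U ∈ 𝓝 vertex) :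
    ∃ g, vertexNhd g ⊆ U := by
  obtain ⟨V, hVU, hV, hxV⟩ := mem_nhds_iff.1 hU
  obtain ⟨g, hg⟩ := (isOpen_iff.1 hV).2 hxV
  refine ⟨g, fun y hy => hVU ?_⟩
  rcases eq_vertex_or_point y with rfl | ⟨n, m, q, rfl⟩
  · exact hxV
  · exact hg n m q (point_mem_vertexNhd.1 hy)

theorem vertexNhd_anti {g h : ℕ → ℕ} (hgh : ∀ n, g n ≤ h n) :
    vertexNhd.{u} h ⊆ vertexNhd g :=
  fun _ hy n m q e => (hgh n).trans_lt (hy n m q e)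

theorem thetaCharacter_vertex_le {κ : Cardinal.{u}} (hκ : Cardinal.aleph0 ≤ κ)
    (hd : Cardinal.lift.{u} dominatingNumber ≤ κ) :
    thetaCharacter RatFan.{u} vertex ≤ κ := by
  obtain ⟨D, hD, hcard⟩ := exists_dominating_mk_eq
  -- The added constant absorbs the finitely many exceptions, turning eventual domination into
  -- domination everywhere.
  let F : D × ℕ → Set RatFan.{u} := fun p => vertexNhd fun n => p.1.1 n + p.2
  have hbase : IsThetaNhdsBase (vertex.{u}) (range F) := by
    refine ⟨?_, fun U hU hxU => ?_⟩
    · rintro _ ⟨p, rfl⟩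
      exact ⟨(isClopen_vertexNhd _).isOpen, _, vertex_mem_vertexNhd _⟩
    · obtain ⟨f, hf⟩ := exists_vertexNhd_subset (hU.mem_nhds hxU)
      obtain ⟨g, hg, hfg⟩ := hD f
      obtain ⟨n₀, hn₀⟩ := eventually_atTop.1 hfg
      refine ⟨_, ⟨⟨⟨g, hg⟩, (Finset.range n₀).sup f⟩, rfl⟩, vertex_mem_vertexNhd _,
        ((vertexNhd_anti fun n => ?_).trans hf).trans subset_closure⟩
      rcases lt_or_ge n n₀ with hn | hn
      · exact (Finset.le_sup (f := f) (Finset.mem_range.2 hn)).trans (Nat.le_add_left _ _)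
      · exact (hn₀ n hn).trans (Nat.le_add_right _ _)
  have hle : thetaCharacter RatFan.{u} vertex ≤ Cardinal.mk (range F) :=
    csInf_le' ⟨_, hbase, rfl⟩
  have hrange := Cardinal.mk_range_le_lift (f := F)
  rw [Cardinal.lift_id'.{0, u}] at hrange
  refine hle.trans (hrange.trans ?_)
  rw [Cardinal.mk_prod, Cardinal.lift_mul, Cardinal.lift_id, Cardinal.lift_id, hcard,
    Cardinal.mk_nat, Cardinal.lift_aleph0]
  exact Cardinal.mul_le_of_le hκ hd hκ

/-- Each spine accumulates at the vertex, but finite selections, one from each spine, are bounded by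
some `g`, and `vertexNhd g` misses them all. -/
theorem not_sFin_vertex : ¬ SFin (thetaOmega vertex.{u}) (thetaOmega vertex.{u}) := by
  intro h
  obtain ⟨B, hB, hmem⟩ := h (fun n => range fun m => point n m 0) fun n => by
    refine ⟨?_, fun U hU => ?_⟩
    · rintro _ ⟨m, rfl⟩
      exact point_ne_vertex _ _ _
    · obtain ⟨g, hg⟩ := exists_vertexNhd_subset hU
      exact ⟨point n (g n + 1) 0,
        subset_closure (hg (point_mem_vertexNhd.2 (Nat.lt_succ_self _))), mem_range_self _⟩
  have hbound : ∀ n, ∃ b, ∀ m, point.{u} n m 0 ∈ B n → m ≤ b := fun n => by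
    have hfin : {m | point.{u} n m 0 ∈ B n}.Finite :=
      (B n).finite_toSet.preimage fun m _ m' _ h => (point_inj.1 h).2.1
    obtain ⟨b, hb⟩ := hfin.bddAbove
    exact ⟨b, fun m hm => hb hm⟩
  choose g hg using hbound
  obtain ⟨y, hy, hyB⟩ := hmem.2 _
    ((isClopen_vertexNhd g).isOpen.mem_nhds (vertex_mem_vertexNhd g))
  rw [(isClopen_vertexNhd g).isClosed.closure_eq] at hy
  obtain ⟨n, hn⟩ := mem_iUnion.1 hyB
  obtain ⟨m, rfl⟩ := hB n hn
  exact (point_mem_vertexNhd.1 hy).not_ge (hg n m hn)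

end RatFan

theorem mainTheorem8 (κ : Cardinal.{u}) (hκ : Cardinal.aleph0 ≤ κ) :
    List.TFAE [
      κ < Cardinal.lift.{u} dominatingNumber,
      ∀ (X : Type u) [TopologicalSpace X] [T1Space X], (∀ y : X, ¬ IsOpen ({y} : Set X)) →
        ∀ x : X, thetaTightness X x = Cardinal.aleph0 → thetaCharacter X x ≤ κ →
          ¬ OneWinsGFin (thetaOmega x) (thetaOmega x),
      ∀ (X : Type u) [TopologicalSpace X] [T1Space X], (∀ y : X, ¬ IsOpen ({y} : Set X)) →
        ∀ x : X, thetaTightness X x = Cardinal.aleph0 → thetaCharacter X x ≤ κ →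
          SFin (thetaOmega x) (thetaOmega x)] := by
  tfae_have 1 → 2 := fun h X _ _ _ x ht hχ => not_oneWinsGFin_of_lt ht (hχ.trans_lt h)
  tfae_have 2 → 3 := fun h X _ _ hX x ht hχ => sFin_of_not_oneWinsGFin (h X hX x ht hχ)
  tfae_have 3 → 1 := fun h => by
    by_contra! hd
    exact RatFan.not_sFin_vertex (h RatFan.{u} RatFan.not_isOpen_singleton_ratFan _
      (thetaTightness_eq_aleph0 _) (RatFan.thetaCharacter_vertex_le hκ hd))
  tfae_finish
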